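/- Let $G$ be a finite group with set of complex irreducible characters $\operatorname{Irr}(G)=\{\chi_1,\ldots,\chi_r\}$. A character of $G$ is called monomial if it is of the form $\lambda^G$ (induced character) for some subgroup $H\leqslant G$ and some linear character $\lambda$ of $H$. The group $G$ is called monomial if every $\chi\in\operatorname{Irr}(G)$ is monomial, and almost monomial if for all distinct $\chi,\psi\in\operatorname{Irr}(G)$ there is a monomial character of $G$ of which $\chi$ is a constituent and $\psi$ is not. Let $M(G)$ be the additive monoid generated by the monomial characters of $G$, let $\{\sigma_1,\ldots,\sigma_p\}$ be its Hilbert basis (minimal system of generators, i.e. the set of its irreducible elements), and write $\sigma_i=a_{i1}\chi_1+\cdots+a_{ir}\chi_r$ with integers $a_{ij}\ge 0$. For a field $K$ put $u_i=\prod_{j=1}^r x_j^{a_{ij}}\in K[x_1,\ldots,x_r]$ and $R_G=K[u_1,\ldots,u_p]$, and let the toric ideal $I_G$ be the kernel of the $K$-algebra epimorphism $K[t_1,\ldots,t_p]\to R_G$, $t_i\mapsto u_i$. If $G$ is almost monomial, $r=|\operatorname{Irr}(G)|\leq 4$ and $I_G=(0)$ for some field $K$, then $G$ is monomial. -/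

import Mathlib

namespace MonomialAlgebra

/-- `Irr(G)`: the set of characters of the irreducible finite-dimensional complex representations
of `G`. -/
def Irr (G : Type*) [Group G] : Set (G → ℂ) :=
  {χ | ∃ (n : ℕ) (ρ : Representation ℂ G (Fin n → ℂ)), ρ.IsIrreducible ∧ ρ.character = χ}

open Classical in
/-- The induced character `λ^G` of a linear character `λ` of a subgroup `H` of `G`:
`λ^G(g) = |H|⁻¹ ∑_{x ∈ G} λ°(x⁻¹ g x)`, where `λ°` is `λ` extended by zero from `H` to `G`. -/
noncomputable def induced {G : Type*} [Group G] [Fintype G] (H : Subgroup G) (lam : H →* ℂˣ) :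
    G → ℂ := fun g =>
  (Nat.card H : ℂ)⁻¹ *
    ∑ x : G, if hx : x⁻¹ * g * x ∈ H then ((lam ⟨x⁻¹ * g * x, hx⟩ : ℂˣ) : ℂ) else 0

/-- `G` is monomial: every irreducible character is induced by a linear character of a subgroup. -/
def IsMonomialGroup (G : Type*) [Group G] [Fintype G] : Prop :=
  ∀ χ ∈ Irr G, ∃ (H : Subgroup G) (lam : H →* ℂˣ), χ = induced H lam

/-- The monoid `Ch(G)` (the characters of `G` together with `0`), in its coordinates with respect
to `Irr(G) = {χ_1, …, χ_r}`: the tuple `(a_j)` of natural numbers stands for `∑ a_j χ_j`. -/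
abbrev Ch (G : Type*) [Group G] : Type _ := Irr G →₀ ℕ

/-- The function `∑ a_j χ_j : G → ℂ` with coordinates `(a_j)`. -/
noncomputable def Ch.toFun {G : Type*} [Group G] (a : Ch G) : G → ℂ :=
  Finsupp.linearCombination ℕ (fun χ : Irr G => (χ : G → ℂ)) a

/-- `Cons(ψ)`: the irreducible characters that occur with a positive coefficient when `ψ` is
written as `∑ a_j χ_j`. -/
def Cons {G : Type*} [Group G] (ψ : G → ℂ) : Set (Irr G) :=
  {χ | ∃ a : Ch G, a.toFun = ψ ∧ 0 < a χ}

/-- `G` is almost monomial. -/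
def IsAlmostMonomialGroup (G : Type*) [Group G] [Fintype G] : Prop :=
  ∀ χ ψ : Irr G, χ ≠ ψ → ∃ (H : Subgroup G) (lam : H →* ℂˣ),
    χ ∈ Cons (induced H lam) ∧ ψ ∉ Cons (induced H lam)

/-- `Mon(G)`: the monomial characters of `G`. -/
def Mon (G : Type*) [Group G] [Fintype G] : Set (Ch G) :=
  {a | ∃ (H : Subgroup G) (lam : H →* ℂˣ), a.toFun = induced H lam}

/-- `M(G)`: the submonoid of `Ch(G)` generated by the monomial characters. -/
noncomputable def M (G : Type*) [Group G] [Fintype G] : AddSubmonoid (Ch G) :=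
  AddSubmonoid.closure (Mon G)

/-- `Hilb(M(G))`: the Hilbert basis of `M(G)`, the set of its irreducible elements, which is the
minimal system of generators. -/
def Hilb (G : Type*) [Group G] [Fintype G] : Set (M G) :=
  {σ | AddIrreducible σ}

/-- The monomial `u = ∏ x_j ^ a_j` in `K[x_1, …, x_r]` with exponents `a = (a_j)`. -/
noncomputable def u (K : Type*) [Field K] {G : Type*} [Group G] (a : Ch G) :
    MvPolynomial (Irr G) K :=
  MvPolynomial.monomial a 1

/-- `R_G = K[M(G)] = K[u_1, …, u_p]`, where the `u_i` are the monomials of the elements of the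
Hilbert basis of `M(G)`. -/
noncomputable def R (K : Type*) [Field K] (G : Type*) [Group G] [Fintype G] :
    Subalgebra K (MvPolynomial (Irr G) K) :=
  Algebra.adjoin K (Set.range fun σ : Hilb G => u K (σ : M G).1)

/-- The canonical epimorphism `Φ : K[t_1, …, t_p] → R_G`, `t_i ↦ u_i`. -/
noncomputable def Phi (K : Type*) [Field K] (G : Type*) [Group G] [Fintype G] :
    MvPolynomial (Hilb G) K →ₐ[K] R K G :=
  MvPolynomial.aeval fun σ : Hilb G =>
    (⟨u K (σ : M G).1, Algebra.subset_adjoin (Set.mem_range_self σ)⟩ : R K G)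

/-- The toric ideal `I_G = Ker Φ`. -/
noncomputable def toricIdeal (K : Type*) [Field K] (G : Type*) [Group G] [Fintype G] :
    Ideal (MvPolynomial (Hilb G) K) :=
  RingHom.ker (Phi K G)

end MonomialAlgebra

/-!
Every finite group `G` with at most four irreducible characters is monomial, so the theorem follows
from the bound on `Irr G`.

Monomiality is detected by common eigenvectors. If an irreducible representation `ρ` has a vector `v`
on which a subgroup `H` acts by scalars, the translates of `v` along `G ⧸ H` span, so the degree of
`ρ` is at most the index of `H`; in case of equality they form a basis permuted up to scalars, and
the character of `ρ` is induced from a linear character of `H` (`exists_eq_induced`). An abelian `H`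
always has a common eigenvector. So it is enough that every degree is `1` or the index of an abelian
subgroup (`degree_of_encard_Irr_le_four`).

The Wedderburn decomposition of `ℂ[G]` into `s` matrix blocks of sizes `d i` gives at least `s`
irreducible characters, so `s ≤ 4`. It also gives `∑ d i ^ 2 = |G|`, at most `s` conjugacy classes,
and that the `d i` are all the degrees, `1` among them. With at most four classes, the class equation
leaves finitely many orders (`card_of_card_conjClasses_le_four`). The orders `20` and `42` do not
occur: there a Sylow subgroup would be cyclic and normal, hence centralized by all commutators, and
the conjugacy classes would be too small. Among the other orders, one plus at most three squares
allows degrees greater than `1` only for the orders `6`, `10`, `12` (all such degrees being `2`, `2`,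
`3`) and `18`. In the first three cases a Sylow subgroup of order `3`, `5`, `4` is abelian of the
required index. In the order `18` a degree `3` would occur, although the abelian Sylow subgroup of
order `9` bounds the degrees by `2`.
-/

namespace MonomialAlgebra

/-! ### Common eigenvectors and induced characters -/

/-- A commuting family of endomorphisms of a finite-dimensional complex vector space has a common
eigenvector in every nonzero subspace stable under the family. -/
theorem exists_common_eigenvector {ι V : Type*} [AddCommGroup V] [Module ℂ V]
    [FiniteDimensional ℂ V] (f : ι → Module.End ℂ V) (hf : ∀ i j, f i * f j = f j * f i)
    (W : Submodule ℂ V) (hW : W ≠ ⊥) (hinv : ∀ i, ∀ w ∈ W, f i w ∈ W) :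
    ∃ v ≠ 0, ∀ i, ∃ c : ℂ, f i v = c • v := by
  induction hn : Module.finrank ℂ W using Nat.strong_induction_on generalizing W with
  | _ n ih =>
    by_cases hall : ∀ i, ∃ c : ℂ, ∀ w ∈ W, f i w = c • w
    · obtain ⟨v, hv, hv0⟩ := W.exists_mem_ne_zero_of_ne_bot hW
      exact ⟨v, hv0, fun i => (hall i).imp fun c hc => hc v hv⟩
    push Not at hall
    obtain ⟨i, hi⟩ := hall
    have : Nontrivial W := W.nontrivial_iff_ne_bot.2 hW
    obtain ⟨μ, hμ⟩ := Module.End.exists_eigenvalue ((f i).restrict (hinv i))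
    obtain ⟨w, hw⟩ := hμ.exists_hasEigenvector
    have hw1 : f i w = μ • (w : V) := congrArg Subtype.val hw.apply_eq_smul
    have hlt : W ⊓ Module.End.eigenspace (f i) μ < W := by
      refine lt_of_le_of_ne inf_le_left fun h => ?_
      obtain ⟨x, hx, hx'⟩ := hi μ
      rw [← h] at hx
      exact hx' (Module.End.mem_eigenspace_iff.1 hx.2)
    refine ih _ (hn ▸ Submodule.finrank_lt_finrank_of_lt hlt) (W ⊓ Module.End.eigenspace (f i) μ)
      (fun h => hw.2 ?_) (fun j x hx => ⟨hinv j x hx.1, ?_⟩) rfl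
    · have : (w : V) ∈ W ⊓ Module.End.eigenspace (f i) μ :=
        ⟨w.2, Module.End.mem_eigenspace_iff.2 hw1⟩
      rw [h] at this
      exact Subtype.ext this
    · have hx2 := Module.End.mem_eigenspace_iff.1 hx.2
      have hc : f i (f j x) = f j (f i x) := congrArg (fun e : Module.End ℂ V => e x) (hf i j)
      exact Module.End.mem_eigenspace_iff.2 (by rw [hc, hx2, map_smul])

/-- The linear character by which a subgroup acts on a common eigenvector. -/
theorem exists_linear_character {G V : Type*} [Group G] [AddCommGroup V] [Module ℂ V]
    (ρ : Representation ℂ G V) (H : Subgroup G) (v : V) (hv0 : v ≠ 0)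
    (hv : ∀ h : H, ∃ c : ℂ, ρ h v = c • v) :
    ∃ lam : H →* ℂˣ, ∀ h : H, ρ h v = (lam h : ℂ) • v := by
  choose c hc using hv
  let c' : H →* ℂ :=
    { toFun := c
      map_one' := by
        apply smul_left_injective ℂ hv0
        simp [← hc]
      map_mul' := fun a b => by
        apply smul_left_injective ℂ hv0
        simp only [← hc]
        rw [Subgroup.coe_mul, map_mul, Module.End.mul_apply, hc b, map_smul, hc a, smul_smul,
          mul_comm] }
  exact ⟨c'.toHomUnits, fun h => hc h⟩

/-- The translates of a common eigenvector of `H` along representatives of `G ⧸ H` are permuted up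
to scalars by `G`. -/
theorem apply_out_smul {G V : Type*} [Group G] [AddCommGroup V] [Module ℂ V]
    (ρ : Representation ℂ G V) (H : Subgroup G) (v : V) (lam : H →* ℂˣ)
    (hlam : ∀ h : H, ρ h v = (lam h : ℂ) • v) (g : G) (q : G ⧸ H) :
    ∃ hm : (g • q).out⁻¹ * g * q.out ∈ H,
      ρ g (ρ q.out v) = (lam ⟨_, hm⟩ : ℂ) • ρ (g • q).out v := by
  have hm : (g • q).out⁻¹ * g * q.out ∈ H := by
    rw [mul_assoc, ← QuotientGroup.eq, QuotientGroup.out_eq']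
    conv_lhs => rw [← QuotientGroup.out_eq' q]
    rfl
  refine ⟨hm, ?_⟩
  have := congrArg (ρ (g • q).out) (hlam ⟨_, hm⟩)
  rw [map_smul] at this
  rw [← this, ← Module.End.mul_apply, ← Module.End.mul_apply, ← map_mul, ← map_mul]
  congr 2
  group

/-- The span of the translates of the eigenvector is stable under `G`, hence everything. -/
theorem span_translates_eq_top {G V : Type*} [Group G] [AddCommGroup V] [Module ℂ V]
    (ρ : Representation ℂ G V) (hρ : ρ.IsIrreducible) (H : Subgroup G) (v : V) (hv0 : v ≠ 0)
    (lam : H →* ℂˣ) (hlam : ∀ h : H, ρ h v = (lam h : ℂ) • v) :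
    Submodule.span ℂ (Set.range fun q : G ⧸ H => ρ q.out v) = ⊤ := by
  let S : Subrepresentation ρ :=
    { toSubmodule := Submodule.span ℂ (Set.range fun q : G ⧸ H => ρ q.out v)
      apply_mem_toSubmodule := fun g w hw => by
        induction hw using Submodule.span_induction with
        | mem x hx =>
          obtain ⟨q, rfl⟩ := hx
          obtain ⟨hm, h⟩ := apply_out_smul ρ H v lam hlam g q
          dsimp only
          rw [h]
          exact Submodule.smul_mem _ _ (Submodule.subset_span ⟨g • q, rfl⟩)
        | zero => simp
        | add x y _ _ hx hy => rw [map_add]; exact Submodule.add_mem _ hx hy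
        | smul a x _ hx => rw [map_smul]; exact Submodule.smul_mem _ _ hx }
  rcases hρ.eq_bot_or_eq_top S with h | h
  · exfalso
    have h1 : ρ (QuotientGroup.mk 1 : G ⧸ H).out v ∈ S.toSubmodule :=
      Submodule.subset_span ⟨_, rfl⟩
    rw [h] at h1
    have h2 : ρ (QuotientGroup.mk 1 : G ⧸ H).out v = 0 := h1
    apply hv0
    have h3 := congrArg (ρ (QuotientGroup.mk 1 : G ⧸ H).out⁻¹) h2
    rwa [map_zero, ← Module.End.mul_apply, ← map_mul, inv_mul_cancel, map_one] at h3
  · exact congrArg Subrepresentation.toSubmodule h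

open Classical in
/-- The induced character as a sum over coset representatives. -/
theorem induced_eq_sum_out {G : Type*} [Group G] [Fintype G] (H : Subgroup G) (lam : H →* ℂˣ)
    (g : G) : induced H lam g =
      ∑ q : G ⧸ H, if hx : q.out⁻¹ * g * q.out ∈ H then ((lam ⟨_, hx⟩ : ℂˣ) : ℂ) else 0 := by
  let φ : (G ⧸ H) × H → G := fun p => p.1.out * p.2
  have hinj : Function.Injective φ := by
    rintro ⟨q, h⟩ ⟨q', h'⟩ heq
    have hq : q = q' := by
      have := congrArg (QuotientGroup.mk (s := H)) heq
      simpa [φ, QuotientGroup.mk_mul_of_mem] using this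
    subst hq
    simpa [φ] using heq
  have hbij : Function.Bijective φ := by
    rw [Fintype.bijective_iff_injective_and_card]
    refine ⟨hinj, ?_⟩
    rw [Fintype.card_eq_nat_card, Fintype.card_eq_nat_card, Nat.card_prod]
    exact H.card_eq_card_quotient_mul_card_subgroup.symm
  have hH : (Nat.card H : ℂ) ≠ 0 := by exact_mod_cast Nat.card_pos.ne'
  rw [induced, ← (Equiv.ofBijective φ hbij).sum_comp, Fintype.sum_prod_type,
    inv_mul_eq_iff_eq_mul₀ hH, Finset.mul_sum]
  refine Finset.sum_congr rfl fun q _ => ?_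
  have hterm : ∀ h : H, (if hx : (Equiv.ofBijective φ hbij (q, h))⁻¹ * g *
      (Equiv.ofBijective φ hbij (q, h)) ∈ H then ((lam ⟨_, hx⟩ : ℂˣ) : ℂ) else 0) =
      if hx : q.out⁻¹ * g * q.out ∈ H then ((lam ⟨_, hx⟩ : ℂˣ) : ℂ) else 0 := by
    intro h
    have he : (Equiv.ofBijective φ hbij (q, h))⁻¹ * g * (Equiv.ofBijective φ hbij (q, h)) =
        (h : G)⁻¹ * (q.out⁻¹ * g * q.out) * h := by
      simp [φ, mul_assoc]
    simp only [he]
    by_cases hx : q.out⁻¹ * g * q.out ∈ H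
    · have hx' : (h : G)⁻¹ * (q.out⁻¹ * g * q.out) * h ∈ H :=
        H.mul_mem (H.mul_mem (H.inv_mem h.2) hx) h.2
      rw [dif_pos hx, dif_pos hx']
      have : (⟨_, hx'⟩ : H) = h⁻¹ * ⟨_, hx⟩ * h := rfl
      rw [this, map_mul, map_mul, map_inv, mul_right_comm, inv_mul_cancel, one_mul]
    · rw [dif_neg hx, dif_neg]
      rwa [H.mul_mem_cancel_right h.2, H.mul_mem_cancel_left (H.inv_mem h.2)]
  rw [Finset.sum_congr rfl fun h _ => hterm h, Finset.sum_const, Finset.card_univ, nsmul_eq_mul,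
    Fintype.card_eq_nat_card]

theorem finrank_le_index {G V : Type*} [Group G] [Finite G] [AddCommGroup V] [Module ℂ V]
    (ρ : Representation ℂ G V) (hρ : ρ.IsIrreducible) (H : Subgroup G) (v : V)
    (hv0 : v ≠ 0) (hv : ∀ h : H, ∃ c : ℂ, ρ h v = c • v) : Module.finrank ℂ V ≤ H.index := by
  obtain ⟨lam, hlam⟩ := exists_linear_character ρ H v hv0 hv
  have := Fintype.ofFinite (G ⧸ H)
  have h := finrank_range_le_card (R := ℂ) (fun q : G ⧸ H => ρ q.out v)
  rw [Set.finrank, span_translates_eq_top ρ hρ H v hv0 lam hlam, finrank_top] at h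
  rwa [Subgroup.index, ← Fintype.card_eq_nat_card]

/-- If the degree of an irreducible representation is the index of a subgroup `H` that has a common
eigenvector, the translates of this vector form a basis in which `G` acts by monomial matrices, and
reading off the trace exhibits the character as induced from `H`. -/
theorem exists_eq_induced {G V : Type*} [Group G] [Fintype G] [AddCommGroup V] [Module ℂ V]
    (ρ : Representation ℂ G V) (hρ : ρ.IsIrreducible) (H : Subgroup G) (v : V)
    (hv0 : v ≠ 0) (hv : ∀ h : H, ∃ c : ℂ, ρ h v = c • v) (hd : Module.finrank ℂ V = H.index) :
    ∃ lam : H →* ℂˣ, ρ.character = induced H lam := by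
  classical
  obtain ⟨lam, hlam⟩ := exists_linear_character ρ H v hv0 hv
  refine ⟨lam, ?_⟩
  let b : Module.Basis (G ⧸ H) ℂ V := basisOfTopLeSpanOfCardEqFinrank
    (fun q : G ⧸ H => ρ q.out v) (span_translates_eq_top ρ hρ H v hv0 lam hlam).ge
    (by rw [hd, Subgroup.index, Fintype.card_eq_nat_card])
  have hb : ∀ q, b q = ρ q.out v := fun q => by simp [b]
  ext g
  rw [induced_eq_sum_out, Representation.character, LinearMap.trace_eq_matrix_trace ℂ b,
    Matrix.trace]
  refine Finset.sum_congr rfl fun q _ => ?_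
  obtain ⟨hm, h⟩ := apply_out_smul ρ H v lam hlam g q
  rw [Matrix.diag_apply, LinearMap.toMatrix_apply, hb, h, ← hb, map_smul, b.repr_self,
    Finsupp.smul_apply, Finsupp.single_apply]
  have hiff : q.out⁻¹ * g * q.out ∈ H ↔ g • q = q := by
    have hgq : ((g * q.out : G) : G ⧸ H) = g • q := by
      conv_rhs => rw [← QuotientGroup.out_eq' q]
      rfl
    rw [mul_assoc, ← QuotientGroup.eq, QuotientGroup.out_eq', hgq, eq_comm]
  by_cases hq : g • q = q
  · have hq' := hiff.2 hq
    rw [dif_pos hq', if_pos hq, smul_eq_mul, mul_one]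
    congr 3
    rw [hq]
  · rw [dif_neg (mt hiff.1 hq), if_neg hq, smul_zero]

theorem exists_eigenvector_of_isMulCommutative {G V : Type*} [Group G] [AddCommGroup V]
    [Module ℂ V] [FiniteDimensional ℂ V] (ρ : Representation ℂ G V) (hρ : ρ.IsIrreducible)
    (H : Subgroup G) [IsMulCommutative H] :
    ∃ v ≠ 0, ∀ h : H, ∃ c : ℂ, ρ h v = c • v := by
  refine exists_common_eigenvector (fun h : H => ρ h) (fun a b => ?_) ⊤ (fun h => ?_) (by simp)
  · rw [← map_mul, ← map_mul, ← H.coe_mul, ← H.coe_mul, mul_comm']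
  · exact hρ.bot_ne_top (Subrepresentation.toSubmodule_injective h.symm)

/-! ### The matrix blocks of the group algebra -/

section Blocks

open scoped MonoidAlgebra

/-- The projection of `ℂ[G]` onto a matrix block, restricted to `G`, as a representation. -/
noncomputable def blockRep {G : Type*} [Group G] {s : ℕ} {d : Fin s → ℕ}
    (e : ℂ[G] ≃ₐ[ℂ] Π i, Matrix (Fin (d i)) (Fin (d i)) ℂ) (i : Fin s) :
    Representation ℂ G (Fin (d i) → ℂ) where
  toFun g := Matrix.toLin' (e (MonoidAlgebra.of ℂ G g) i)
  map_one' := by rw [map_one, map_one, Pi.one_apply, Matrix.toLin'_one]; rfl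
  map_mul' g h := by
    rw [map_mul, map_mul, Pi.mul_apply, Matrix.toLin'_mul]
    rfl

variable {G : Type*} [Group G] {s : ℕ} {d : Fin s → ℕ}

theorem blockRep_character (e : ℂ[G] ≃ₐ[ℂ] Π i, Matrix (Fin (d i)) (Fin (d i)) ℂ)
    (i : Fin s) (g : G) :
    (blockRep e i).character g = (e (MonoidAlgebra.of ℂ G g) i).trace := by
  simp [Representation.character, blockRep]

theorem blockRep_invariant (e : ℂ[G] ≃ₐ[ℂ] Π i, Matrix (Fin (d i)) (Fin (d i)) ℂ)
    (i : Fin s) (S : Subrepresentation (blockRep e i)) (a : ℂ[G])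
    (w : Fin (d i) → ℂ) (hw : w ∈ S.toSubmodule) :
    Matrix.toLin' (e a i) w ∈ S.toSubmodule := by
  induction a using MonoidAlgebra.induction_on with
  | of g => exact S.apply_mem_toSubmodule g hw
  | add a b ha hb =>
    rw [map_add, Pi.add_apply, map_add, LinearMap.add_apply]
    exact S.toSubmodule.add_mem ha hb
  | smul r a ha =>
    rw [map_smul, Pi.smul_apply, map_smul, LinearMap.smul_apply]
    exact S.toSubmodule.smul_mem r ha

/-- Since `ℂ[G]` maps onto each matrix block, every block is an irreducible representation. -/
theorem blockRep_isIrreducible (e : ℂ[G] ≃ₐ[ℂ] Π i, Matrix (Fin (d i)) (Fin (d i)) ℂ)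
    (i : Fin s) (hi : d i ≠ 0) : (blockRep e i).IsIrreducible := by
  have : Nonempty (Fin (d i)) := ⟨⟨0, Nat.pos_of_ne_zero hi⟩⟩
  refine { exists_pair_ne := ⟨⊥, ⊤, fun h => ?_⟩, eq_bot_or_eq_top := fun S => ?_ }
  · exact bot_ne_top (α := Submodule ℂ (Fin (d i) → ℂ))
      (congrArg Subrepresentation.toSubmodule h)
  · by_cases hS : S.toSubmodule = ⊥
    · exact Or.inl (Subrepresentation.toSubmodule_injective hS)
    · right
      obtain ⟨w, hw, hw0⟩ := S.toSubmodule.exists_mem_ne_zero_of_ne_bot hS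
      apply Subrepresentation.toSubmodule_injective
      refine eq_top_iff.2 fun v _ => ?_
      obtain ⟨k, hk⟩ := Function.ne_iff.1 hw0
      let f : Module.End ℂ (Fin (d i) → ℂ) := (LinearMap.proj k).smulRight ((w k)⁻¹ • v)
      have hf : f w = v := by
        simp only [f, LinearMap.smulRight_apply, LinearMap.proj_apply]
        exact smul_inv_smul₀ hk v
      have := blockRep_invariant e i S (e.symm (Pi.single i (LinearMap.toMatrix' f))) w hw
      rwa [AlgEquiv.apply_symm_apply, Pi.single_eq_same, Matrix.toLin'_toMatrix', hf] at this

theorem blockRep_character_injective (e : ℂ[G] ≃ₐ[ℂ] Π i, Matrix (Fin (d i)) (Fin (d i)) ℂ)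
    (hd : ∀ i, d i ≠ 0) :
    Function.Injective fun i => (blockRep e i).character := by
  intro i j hij
  by_contra hne
  have key : ∀ a : ℂ[G], (e a i).trace = (e a j).trace := by
    intro a
    induction a using MonoidAlgebra.induction_on with
    | of g => simpa only [blockRep_character] using congrFun hij g
    | add a b ha hb => simp only [map_add, Pi.add_apply, Matrix.trace_add, ha, hb]
    | smul r a ha => simp only [map_smul, Pi.smul_apply, Matrix.trace_smul, ha]
  have h := key (e.symm (Pi.single i 1))
  rw [AlgEquiv.apply_symm_apply, Pi.single_eq_same, Pi.single_eq_of_ne (Ne.symm hne)] at h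
  exact hd i (by simpa using h)

theorem card_blocks_le_encard_Irr (e : ℂ[G] ≃ₐ[ℂ] Π i, Matrix (Fin (d i)) (Fin (d i)) ℂ)
    (hd : ∀ i, d i ≠ 0) : (s : ℕ∞) ≤ (Irr G).encard := by
  have h := (blockRep_character_injective e hd).encard_range
  rw [ENat.card_eq_coe_fintype_card, Fintype.card_fin] at h
  refine h.trans (Set.encard_le_encard ?_)
  rintro _ ⟨i, rfl⟩
  exact ⟨d i, blockRep e i, blockRep_isIrreducible e i (hd i), rfl⟩

variable [Fintype G]

theorem sum_sq_blocks (e : ℂ[G] ≃ₐ[ℂ] Π i, Matrix (Fin (d i)) (Fin (d i)) ℂ) :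
    ∑ i, d i ^ 2 = Fintype.card G := by
  have h := e.toLinearEquiv.finrank_eq
  rw [Module.finrank_eq_card_basis (MonoidAlgebra.basis G ℂ)] at h
  simp only [Module.finrank_pi_fintype, Module.finrank_matrix, Fintype.card_fin,
    Module.finrank_self, mul_one] at h
  simpa [sq] using h.symm

/-- A class function `f` is zero as soon as the central element `∑ f(g) g` of `ℂ[G]`, which acts on
every block by a scalar, has trace zero on every block. -/
theorem eq_zero_of_trace_eq_zero (e : ℂ[G] ≃ₐ[ℂ] Π i, Matrix (Fin (d i)) (Fin (d i)) ℂ)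
    (hd : ∀ i, d i ≠ 0) (f : G → ℂ)
    (hf : ∀ g x, f (x * g * x⁻¹) = f g)
    (h0 : ∀ i, ∑ g, f g * (blockRep e i).character g = 0) : f = 0 := by
  set a : ℂ[G] := ∑ g, f g • MonoidAlgebra.of ℂ G g with ha
  have hcomm : ∀ b : ℂ[G], b * a = a * b := by
    intro b
    induction b using MonoidAlgebra.induction_on with
    | of x =>
      rw [ha, Finset.mul_sum, Finset.sum_mul, ← (MulAut.conj x⁻¹).toEquiv.sum_comp]
      refine Finset.sum_congr rfl fun g _ => ?_
      have h1 : f ((MulAut.conj x⁻¹).toEquiv g) = f g := by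
        simpa using hf g x⁻¹
      rw [h1, mul_smul_comm, smul_mul_assoc, ← map_mul, ← map_mul]
      congr 2
      simp [mul_assoc]
    | add b c hb hc => rw [add_mul, mul_add, hb, hc]
    | smul r b hb => rw [smul_mul_assoc, mul_smul_comm, hb]
  have htr : ∀ i, (e a i).trace = 0 := by
    intro i
    rw [← h0 i, ha, map_sum, Finset.sum_apply, Matrix.trace_sum]
    refine Finset.sum_congr rfl fun g _ => ?_
    rw [map_smul, Pi.smul_apply, Matrix.trace_smul, blockRep_character, smul_eq_mul]
  have hea : e a = 0 := by
    ext1 i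
    have hc : e a i ∈ Set.center (Matrix (Fin (d i)) (Fin (d i)) ℂ) := by
      rw [Semigroup.mem_center_iff]
      intro N
      have := congrArg (fun z => e z i) (hcomm (e.symm (Pi.single i N)))
      simpa using this
    rw [Matrix.center_eq_scalar_image] at hc
    obtain ⟨c, -, hc⟩ := hc
    have h := htr i
    rw [← hc] at h
    have hc0 : c = 0 := by simpa [Matrix.scalar_apply, hd i] using h
    rw [← hc, hc0, map_zero, Pi.zero_apply]
  have ha0 : a = 0 := by simpa using hea
  have hli := (MonoidAlgebra.basis G ℂ).linearIndependent
  rw [Fintype.linearIndependent_iff] at hli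
  funext g
  refine hli f ?_ g
  rw [← ha0, ha]
  simp [MonoidAlgebra.of]

theorem card_conjClasses_le_blocks (e : ℂ[G] ≃ₐ[ℂ] Π i, Matrix (Fin (d i)) (Fin (d i)) ℂ)
    (hd : ∀ i, d i ≠ 0) : Nat.card (ConjClasses G) ≤ s := by
  classical
  have := Fintype.ofFinite (ConjClasses G)
  let T : (ConjClasses G → ℂ) →ₗ[ℂ] (Fin s → ℂ) :=
    { toFun := fun f i => ∑ g, f (ConjClasses.mk g) * (blockRep e i).character g
      map_add' := fun f f' => by ext i; simp [add_mul, Finset.sum_add_distrib]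
      map_smul' := fun r f => by ext i; simp [Finset.mul_sum, mul_assoc] }
  have hT : Function.Injective T := by
    rw [← LinearMap.ker_eq_bot, LinearMap.ker_eq_bot']
    intro f hf
    have h := eq_zero_of_trace_eq_zero e hd (fun g => f (ConjClasses.mk g))
      (fun g x => congrArg f (ConjClasses.mk_eq_mk_iff_isConj.2
        (isConj_iff.2 ⟨x⁻¹, by simp [mul_assoc]⟩))) (fun i => congrFun hf i)
    funext c
    obtain ⟨g, rfl⟩ := ConjClasses.mk_surjective c
    exact congrFun h g
  simpa using LinearMap.finrank_le_finrank_of_injective hT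

/-- Every irreducible representation has the degree of some block: otherwise its character would be
orthogonal to the characters of all blocks. -/
theorem exists_block_degree (e : ℂ[G] ≃ₐ[ℂ] Π i, Matrix (Fin (d i)) (Fin (d i)) ℂ)
    (hd : ∀ i, d i ≠ 0) {n : ℕ} (ρ : Representation ℂ G (Fin n → ℂ))
    (hρ : ρ.IsIrreducible) : ∃ i, d i = n := by
  by_contra hne
  push Not at hne
  have hG : (Nat.card G : ℂ) ≠ 0 := by exact_mod_cast Nat.card_pos.ne'
  have := invertibleOfNonzero hG
  have h := eq_zero_of_trace_eq_zero e hd (fun g => ρ.character g⁻¹) (fun g x => by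
    simp only [mul_inv_rev, inv_inv, ← mul_assoc]
    rw [Representation.char_conj]) (fun i => by
    have := blockRep_isIrreducible e i (hd i)
    have ho := Representation.char_orthonormal (blockRep e i) ρ
    rw [if_neg, mul_eq_zero, or_iff_right (inv_ne_zero hG)] at ho
    · simpa only [mul_comm] using ho
    · rintro ⟨φ⟩
      have := φ.toLinearEquiv.finrank_eq
      simp at this
      exact hne i this.symm)
  have h1 := congrFun h 1
  simp at h1
  subst h1
  exact hρ.bot_ne_top (Subrepresentation.toSubmodule_injective (Subsingleton.elim _ _))

theorem exists_block_degree_one (e : ℂ[G] ≃ₐ[ℂ] Π i, Matrix (Fin (d i)) (Fin (d i)) ℂ)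
    (hd : ∀ i, d i ≠ 0) : ∃ i, d i = 1 := by
  refine exists_block_degree e hd (Representation.trivial ℂ G (Fin 1 → ℂ)) ?_
  have hs : IsSimpleOrder (Submodule ℂ (Fin 1 → ℂ)) :=
    (isSimpleModule_iff ℂ _).1 (isSimpleModule_iff_finrank_eq_one.2 (by simp))
  refine { exists_pair_ne := ⟨⊥, ⊤, fun h => ?_⟩, eq_bot_or_eq_top := fun S => ?_ }
  · exact bot_ne_top (α := Submodule ℂ (Fin 1 → ℂ)) (congrArg Subrepresentation.toSubmodule h)
  · exact (hs.eq_bot_or_eq_top S.toSubmodule).imp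
      (fun h => Subrepresentation.toSubmodule_injective h)
      (fun h => Subrepresentation.toSubmodule_injective h)

end Blocks

/-! ### Conjugacy classes and cyclic normal subgroups -/

theorem ncard_conjClass_mul_card_centralizer {G : Type*} [Group G] [Finite G] (g : G) :
    (ConjClasses.mk g).carrier.ncard * Nat.card (Subgroup.centralizer {g}) = Nat.card G := by
  rw [← ConjAct.orbit_eq_carrier_conjClasses, ← MulAction.index_stabilizer,
    Subgroup.nat_card_centralizer_nat_card_stabilizer, Subgroup.index_mul_card]
  rfl

theorem ncard_conjClass_dvd_card {G : Type*} [Group G] [Finite G] (c : ConjClasses G) :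
    c.carrier.ncard ∣ Nat.card G := by
  obtain ⟨g, rfl⟩ := ConjClasses.mk_surjective c
  exact ⟨_, (ncard_conjClass_mul_card_centralizer g).symm⟩

/-- Automorphisms of a cyclic group commute, so commutators of `G` centralize a cyclic normal
subgroup `P`. Hence the conjugacy class of any `g` lies in `g C(x)` for `x ∈ P`. -/
theorem ncard_conjClass_mul_le {G : Type*} [Group G] [Finite G] (P : Subgroup G) [P.Normal]
    [IsCyclic P] (x : G) (hx : x ∈ P) (g : G) :
    (ConjClasses.mk g).carrier.ncard * (ConjClasses.mk x).carrier.ncard ≤ Nat.card G := by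
  rw [← ncard_conjClass_mul_card_centralizer x, mul_comm]
  refine Nat.mul_le_mul_left _ ?_
  have hpow : ∀ h : G, ∃ a : ℤ, ∀ z ∈ P, h * z * h⁻¹ = z ^ a := by
    intro h
    obtain ⟨a, ha⟩ := MonoidHom.map_cyclic (MulAut.conjNormal (H := P) h).toMonoidHom
    exact ⟨a, fun z hz => by simpa using congrArg Subtype.val (ha ⟨z, hz⟩)⟩
  have hcomm : ∀ h k : G, ∀ z ∈ P, h * (k * z * k⁻¹) * h⁻¹ = k * (h * z * h⁻¹) * k⁻¹ := by
    intro h k z hz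
    obtain ⟨a, ha⟩ := hpow h
    obtain ⟨b, hb⟩ := hpow k
    rw [ha z hz, hb z hz, ha _ (P.zpow_mem hz b), hb _ (P.zpow_mem hz a), ← zpow_mul, ← zpow_mul,
      mul_comm]
  have hsub : (ConjClasses.mk g).carrier ⊆
      (fun c => g * c) '' (Subgroup.centralizer {x} : Set G) := by
    intro y hy
    rw [ConjClasses.mem_carrier_iff_mk_eq, ConjClasses.mk_eq_mk_iff_isConj, isConj_comm,
      isConj_iff] at hy
    obtain ⟨k, rfl⟩ := hy
    refine ⟨g⁻¹ * (k * g * k⁻¹), ?_, by simp⟩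
    rw [SetLike.mem_coe, Subgroup.mem_centralizer_singleton_iff]
    have hz : k⁻¹ * x * k ∈ P := by
      simpa using Subgroup.Normal.conj_mem inferInstance x hx k⁻¹
    have h := hcomm k g _ hz
    have h1 : k * g * k⁻¹ * x * (k * g * k⁻¹)⁻¹ = g * x * g⁻¹ := by
      calc _ = k * (g * (k⁻¹ * x * k) * g⁻¹) * k⁻¹ := by group
        _ = g * (k * (k⁻¹ * x * k) * k⁻¹) * g⁻¹ := h
        _ = _ := by group
    rw [mul_inv_eq_iff_eq_mul] at h1
    rw [mul_assoc, h1]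
    group
  calc _ ≤ ((fun c => g * c) '' (Subgroup.centralizer {x} : Set G)).ncard :=
        Set.ncard_le_ncard hsub (Set.toFinite _)
    _ ≤ (Subgroup.centralizer {x} : Set G).ncard := Set.ncard_image_le (Set.toFinite _)
    _ = _ := rfl

theorem exists_normal_of_card_eq_prime_mul {G : Type*} [Group G] [Finite G] {p m : ℕ}
    (hp : p.Prime) (hm : 0 < m) (hmp : m < p) (hG : Nat.card G = p * m) :
    ∃ P : Subgroup G, P.Normal ∧ Nat.card P = p := by
  have := Fact.mk hp
  obtain ⟨Q, hQ⟩ := Sylow.exists_subgroup_card_pow_prime (G := G) p (n := 1)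
    (by rw [hG, pow_one]; exact dvd_mul_right p m)
  rw [pow_one] at hQ
  have hnd : ¬ p ∣ m := fun h => absurd (Nat.le_of_dvd hm h) (by omega)
  have hfac : (Nat.card G).factorization p = 1 := by
    rw [hG, Nat.factorization_mul hp.ne_zero hm.ne', Finsupp.add_apply, hp.factorization_self,
      Nat.factorization_eq_zero_of_not_dvd hnd]
  let P : Sylow p G := Sylow.ofCard Q (by rw [hQ, hfac, pow_one])
  have hidx : (P : Subgroup G).index = m := by
    have h := Q.index_mul_card
    rw [hQ, hG, mul_comm] at h
    exact Nat.eq_of_mul_eq_mul_left hp.pos h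
  have h1 : Nat.card (Sylow p G) = 1 :=
    Nat.ModEq.eq_of_lt_of_lt (card_sylow_modEq_one p G)
      (lt_of_le_of_lt (Nat.le_of_dvd hm (hidx ▸ P.card_dvd_index)) hmp) hp.one_lt
  have := (Nat.card_eq_one_iff_unique.1 h1).1
  exact ⟨P, Sylow.normal_of_subsingleton P, hQ⟩

/-! ### The class equation with at most four classes -/

/-- A sum over at most four indices, one of which is singled out. -/
theorem sum_of_card_le_four {ι : Type*} [Fintype ι] (i₀ : ι) (f : ι → ℕ)
    (h : Fintype.card ι ≤ 4) :
    (Fintype.card ι = 1 ∧ (∀ i, i = i₀) ∧ ∑ i, f i = f i₀) ∨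
    (Fintype.card ι = 2 ∧ ∃ x, (∀ i, i = i₀ ∨ i = x) ∧ ∑ i, f i = f i₀ + f x) ∨
    (Fintype.card ι = 3 ∧ ∃ x y, (∀ i, i = i₀ ∨ i = x ∨ i = y) ∧
      ∑ i, f i = f i₀ + f x + f y) ∨
    (Fintype.card ι = 4 ∧ ∃ x y z,
      (∀ i, i = i₀ ∨ i = x ∨ i = y ∨ i = z) ∧ ∑ i, f i = f i₀ + f x + f y + f z) := by
  classical
  have hsum := Finset.add_sum_erase Finset.univ f (Finset.mem_univ i₀)
  have hmem : ∀ i, i = i₀ ∨ i ∈ Finset.univ.erase i₀ := fun i => by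
    simpa using em (i = i₀)
  have hpos : 0 < Fintype.card ι := Fintype.card_pos_iff.2 ⟨i₀⟩
  have hcard : (Finset.univ.erase i₀).card = Fintype.card ι - 1 := by
    rw [Finset.card_erase_of_mem (Finset.mem_univ i₀), Finset.card_univ]
  generalize Finset.univ.erase i₀ = s at *
  obtain hk | hk | hk | hk : Fintype.card ι = 1 ∨ Fintype.card ι = 2 ∨ Fintype.card ι = 3 ∨
    Fintype.card ι = 4 := by omega
  · left
    obtain rfl := Finset.card_eq_zero.1 (hcard.trans (by omega))
    exact ⟨hk, by simpa using hmem, by simpa using hsum.symm⟩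
  · right; left
    obtain ⟨x, rfl⟩ := Finset.card_eq_one.1 (hcard.trans (by omega))
    exact ⟨hk, x, by simpa using hmem, by simpa using hsum.symm⟩
  · right; right; left
    obtain ⟨x, y, hxy, rfl⟩ := Finset.card_eq_two.1 (hcard.trans (by omega))
    refine ⟨hk, x, y, by simpa using hmem, ?_⟩
    rw [← hsum, Finset.sum_pair hxy, add_assoc]
  · right; right; right
    obtain ⟨x, y, z, hxy, hxz, hyz, rfl⟩ := Finset.card_eq_three.1 (hcard.trans (by omega))
    refine ⟨hk, x, y, z, by simpa using hmem, ?_⟩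
    rw [← hsum, Finset.sum_insert (by simp [hxy, hxz]), Finset.sum_pair hyz]
    ring

theorem eq_of_one_add_dvd {N a : ℕ} (ha : a ∣ N) (h : 1 + a = N) : N = 2 := by
  have : a ∣ 1 := (Nat.dvd_add_left (dvd_refl a)).1 (h ▸ ha)
  have := Nat.dvd_one.1 this
  omega

theorem eq_of_one_add_dvd_dvd {N a b : ℕ} (ha : a ∣ N) (hb : b ∣ N) (h : 1 + a + b = N) :
    N = 3 ∨ N = 4 ∨ N = 6 := by
  wlog hab : a ≤ b generalizing a b
  · exact this hb ha (by rw [← h]; ring) (le_of_not_ge hab)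
  have hb1 : b ∣ 1 + a := (Nat.dvd_add_left (dvd_refl b)).1 (h ▸ hb)
  obtain ⟨t, ht⟩ := hb1
  have hb0 : 0 < b := Nat.pos_of_ne_zero (by rintro rfl; omega)
  have ht2 : t ≤ 2 := by
    by_contra hlt
    have : b * 3 ≤ b * t := Nat.mul_le_mul_left b (by omega)
    omega
  interval_cases t
  · omega
  · have : a ∣ 2 := by
      have h2 : a ∣ 2 + 2 * a := by rw [show 2 + 2 * a = N by omega]; exact ha
      exact (Nat.dvd_add_left (dvd_mul_left a 2)).1 h2
    have h0 := Nat.pos_of_dvd_of_pos this (by norm_num)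
    have := Nat.le_of_dvd (by norm_num) this
    interval_cases a <;> omega
  · omega

/-- The class equation with four classes. In the orders `20` and `42` the class sizes are
`1, 4, 5, 10` and `1, 6, 14, 21`; only the recorded consequences are needed. -/
theorem eq_of_one_add_dvd_dvd_dvd_of_le {N a b c : ℕ} (ha : a ∣ N) (hb : b ∣ N) (hc : c ∣ N)
    (h : 1 + a + b + c = N) (hab : a ≤ b) (hbc : b ≤ c) :
    (N = 4 ∨ N = 6 ∨ N = 8 ∨ N = 10 ∨ N = 12 ∨ N = 18 ∨ N = 20 ∨ N = 24 ∨ N = 42) ∧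
    (N = 20 ∨ N = 42 → 2 * c = N ∧ 3 ≤ a ∧ 3 ≤ b ∧ 3 ≤ c) := by
  have ha0 : 0 < a := Nat.pos_of_ne_zero (by rintro rfl; simp at ha; omega)
  obtain ⟨t, ht⟩ := hc
  have ht4 : t ≤ 4 := by
    by_contra hlt
    have : c * 5 ≤ c * t := Nat.mul_le_mul_left c (by omega)
    omega
  interval_cases t
  · omega
  · omega
  -- `c = N / 2`, hence `c = 1 + a + b`
  · have hb1 : b ∣ 2 + 2 * a := by
      rw [show N = 2 + 2 * a + 2 * b by omega] at hb
      exact (Nat.dvd_add_left (dvd_mul_left b 2)).1 hb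
    obtain ⟨s, hs⟩ := hb1
    have hs4 : s ≤ 4 := by
      by_contra hlt
      have : b * 5 ≤ b * s := Nat.mul_le_mul_left b (by omega)
      omega
    interval_cases s
    · omega
    · have h6 : a ∣ 6 := by
        rw [show N = 6 + 6 * a by omega] at ha
        exact (Nat.dvd_add_left (dvd_mul_left a 6)).1 ha
      have := Nat.le_of_dvd (by norm_num) h6
      interval_cases a <;> omega
    · have h4 : a ∣ 4 := by
        rw [show N = 4 + 4 * a by omega] at ha
        exact (Nat.dvd_add_left (dvd_mul_left a 4)).1 ha
      have := Nat.le_of_dvd (by norm_num) h4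
      interval_cases a <;> omega
    · omega
    · omega
  -- `c = N / 3`, hence `b = c = 1 + a`
  · have h3 : a ∣ 3 := by
      rw [show N = 3 + 3 * a by omega] at ha
      exact (Nat.dvd_add_left (dvd_mul_left a 3)).1 ha
    have := Nat.le_of_dvd (by norm_num) h3
    interval_cases a <;> omega
  · omega

theorem eq_of_one_add_dvd_dvd_dvd {N a b c : ℕ} (ha : a ∣ N) (hb : b ∣ N) (hc : c ∣ N)
    (h : 1 + a + b + c = N) :
    (N = 4 ∨ N = 6 ∨ N = 8 ∨ N = 10 ∨ N = 12 ∨ N = 18 ∨ N = 20 ∨ N = 24 ∨ N = 42) ∧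
    (N = 20 ∨ N = 42 → (2 * a = N ∨ 2 * b = N ∨ 2 * c = N) ∧ 3 ≤ a ∧ 3 ≤ b ∧ 3 ≤ c) := by
  rcases le_total a b with hab | hab <;> rcases le_total b c with hbc | hbc <;>
    rcases le_total a c with hac | hac
  · have := eq_of_one_add_dvd_dvd_dvd_of_le ha hb hc (by omega) hab hbc; omega
  · have := eq_of_one_add_dvd_dvd_dvd_of_le ha hb hc (by omega) hab hbc; omega
  · have := eq_of_one_add_dvd_dvd_dvd_of_le ha hc hb (by omega) hac hbc; omega
  · have := eq_of_one_add_dvd_dvd_dvd_of_le hc ha hb (by omega) hac hab; omega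
  · have := eq_of_one_add_dvd_dvd_dvd_of_le hb ha hc (by omega) hab hac; omega
  · have := eq_of_one_add_dvd_dvd_dvd_of_le hb hc ha (by omega) hbc hac; omega
  · have := eq_of_one_add_dvd_dvd_dvd_of_le hc hb ha (by omega) hbc hab; omega
  · have := eq_of_one_add_dvd_dvd_dvd_of_le hc hb ha (by omega) hbc hab; omega

/-- The orders allowed by the class equation for a group with at most four classes. Orders `20` and
`42` are excluded because the Sylow subgroup for `5`, respectively `7`, would be cyclic and
normal. -/
theorem card_of_card_conjClasses_le_four {G : Type*} [Group G] [Finite G]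
    (hk : Nat.card (ConjClasses G) ≤ 4) :
    (Nat.card (ConjClasses G) = 1 ∧ Nat.card G = 1) ∨
    (Nat.card (ConjClasses G) = 2 ∧ Nat.card G = 2) ∨
    (Nat.card (ConjClasses G) = 3 ∧ (Nat.card G = 3 ∨ Nat.card G = 4 ∨ Nat.card G = 6)) ∨
    (Nat.card (ConjClasses G) = 4 ∧ (Nat.card G = 4 ∨ Nat.card G = 6 ∨ Nat.card G = 8 ∨
      Nat.card G = 10 ∨ Nat.card G = 12 ∨ Nat.card G = 18 ∨ Nat.card G = 24)) := by
  have := Fintype.ofFinite (ConjClasses G)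
  have hsum := Group.sum_card_conj_classes_eq_card G
  rw [finsum_eq_sum_of_fintype] at hsum
  have h1 : (1 : ConjClasses G).carrier.ncard = 1 := by
    have := ncard_conjClass_mul_card_centralizer (1 : G)
    have hc : Subgroup.centralizer {(1 : G)} = ⊤ := by
      ext; simp [Subgroup.mem_centralizer_singleton_iff]
    rw [hc, Subgroup.card_top] at this
    exact Nat.eq_of_mul_eq_mul_right Nat.card_pos (this.trans (one_mul _).symm)
  have hd := ncard_conjClass_dvd_card (G := G)
  rw [← Fintype.card_eq_nat_card] at hk ⊢
  rcases sum_of_card_le_four (1 : ConjClasses G) (fun c => c.carrier.ncard) hk with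
    ⟨hc, -, hs⟩ | ⟨hc, x, -, hs⟩ | ⟨hc, x, y, -, hs⟩ |
    ⟨hc, x, y, z, hall, hs⟩ <;> simp only [h1, hsum] at hs
  · exact Or.inl ⟨hc, hs⟩
  · exact Or.inr (Or.inl ⟨hc, eq_of_one_add_dvd (hd x) hs.symm⟩)
  · exact Or.inr (Or.inr (Or.inl ⟨hc, eq_of_one_add_dvd_dvd (hd x) (hd y) hs.symm⟩))
  · right; right; right
    refine ⟨hc, ?_⟩
    obtain ⟨hN, hbig⟩ := eq_of_one_add_dvd_dvd_dvd (hd x) (hd y) (hd z) hs.symm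
    suffices ¬ (Nat.card G = 20 ∨ Nat.card G = 42) by omega
    intro hN'
    obtain ⟨hhalf, hx3, hy3, hz3⟩ := hbig hN'
    obtain ⟨p, hp, P, hP, hPp⟩ :
        ∃ p : ℕ, p.Prime ∧ ∃ P : Subgroup G, P.Normal ∧ Nat.card P = p := by
      rcases hN' with h | h
      · exact ⟨5, by norm_num,
          exists_normal_of_card_eq_prime_mul (m := 4) (by norm_num) (by norm_num) (by norm_num) h⟩
      · exact ⟨7, by norm_num,
          exists_normal_of_card_eq_prime_mul (m := 6) (by norm_num) (by norm_num) (by norm_num) h⟩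
    have := Fact.mk hp
    have hcyc : IsCyclic P := isCyclic_of_prime_card hPp
    have : Nontrivial P := Finite.one_lt_card_iff_nontrivial.1 (hPp ▸ hp.one_lt)
    obtain ⟨w, hw⟩ := exists_ne (1 : P)
    have hw3 : 3 ≤ (ConjClasses.mk (w : G)).carrier.ncard := by
      rcases hall (ConjClasses.mk (w : G)) with h | h | h | h
      · refine absurd (Subtype.ext ?_) hw
        rw [ConjClasses.one_eq_mk_one, ConjClasses.mk_eq_mk_iff_isConj] at h
        exact isConj_one_left.1 h
      all_goals rw [h]; assumption
    obtain ⟨c, hc2⟩ : ∃ c : ConjClasses G, 2 * c.carrier.ncard = Nat.card G := by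
      rcases hhalf with h | h | h
      exacts [⟨x, h⟩, ⟨y, h⟩, ⟨z, h⟩]
    obtain ⟨g, rfl⟩ := ConjClasses.mk_surjective c
    have hle := ncard_conjClass_mul_le P w w.2 g
    have := Nat.mul_le_mul_left (ConjClasses.mk g).carrier.ncard hw3
    omega

/-! ### Degrees -/

theorem le_four_of_sq_add_eq {n N k : ℕ} (h : n ^ 2 + k = N) (hN : N ≤ 24) : n ≤ 4 := by
  by_contra hlt
  have : 5 ^ 2 ≤ n ^ 2 := Nat.pow_le_pow_left (by omega) 2
  omega

/-- The sums of squares of four degrees that match an order from the class equation. -/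
theorem degrees_of_one_add_three_squares {N x y z : ℕ} (hx : x ≠ 0) (hy : y ≠ 0) (hz : z ≠ 0)
    (hN : N = 4 ∨ N = 6 ∨ N = 8 ∨ N = 10 ∨ N = 12 ∨ N = 18 ∨ N = 24)
    (h : 1 + x ^ 2 + y ^ 2 + z ^ 2 = N) :
    (N = 4 ∧ x = 1 ∧ y = 1 ∧ z = 1) ∨
    (N = 10 ∧ (x = 1 ∨ x = 2) ∧ (y = 1 ∨ y = 2) ∧ (z = 1 ∨ z = 2)) ∨
    (N = 12 ∧ (x = 1 ∨ x = 3) ∧ (y = 1 ∨ y = 3) ∧ (z = 1 ∨ z = 3)) ∨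
    (N = 18 ∧ (x = 3 ∨ y = 3 ∨ z = 3)) := by
  have hx4 : x ≤ 4 := le_four_of_sq_add_eq (k := 1 + y ^ 2 + z ^ 2) (N := N) (by omega) (by omega)
  have hy4 : y ≤ 4 := le_four_of_sq_add_eq (k := 1 + x ^ 2 + z ^ 2) (N := N) (by omega) (by omega)
  have hz4 : z ≤ 4 := le_four_of_sq_add_eq (k := 1 + x ^ 2 + y ^ 2) (N := N) (by omega) (by omega)
  interval_cases x <;> interval_cases y <;> interval_cases z <;> omega

theorem isMulCommutative_of_card_prime_pow {A : Type*} [Group A] {p a : ℕ} (hp : p.Prime)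
    (ha : a = 1 ∨ a = 2) (hA : Nat.card A = p ^ a) : IsMulCommutative A := by
  have := Fact.mk hp
  rcases ha with rfl | rfl
  · rw [pow_one] at hA
    have : IsCyclic A := isCyclic_of_prime_card hA
    exact inferInstance
  · exact IsPGroup.isMulCommutative_of_card_eq_prime_sq hA

theorem exists_isMulCommutative_index {G : Type*} [Group G] [Finite G] {p a m : ℕ}
    (hp : p.Prime) (ha : a = 1 ∨ a = 2) (hG : Nat.card G = p ^ a * m) :
    ∃ H : Subgroup G, IsMulCommutative H ∧ H.index = m := by
  have := Fact.mk hp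
  obtain ⟨H, hH⟩ := Sylow.exists_subgroup_card_pow_prime (G := G) p (hG ▸ dvd_mul_right (p ^ a) m)
  refine ⟨H, isMulCommutative_of_card_prime_pow hp ha hH, ?_⟩
  have h := H.card_mul_index
  rw [hH, hG] at h
  exact Nat.eq_of_mul_eq_mul_left (pow_pos hp.pos a) h

/-- The degree of an irreducible representation is at most the index of an abelian subgroup, and in
case of equality the character is monomial. -/
theorem finrank_le_index_of_isMulCommutative {G : Type*} [Group G] [Fintype G] {n : ℕ}
    (ρ : Representation ℂ G (Fin n → ℂ)) (hρ : ρ.IsIrreducible) (H : Subgroup G)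
    [IsMulCommutative H] :
    n ≤ H.index ∧ (n = H.index → ∃ lam : H →* ℂˣ, ρ.character = induced H lam) := by
  obtain ⟨v, hv0, hv⟩ := exists_eigenvector_of_isMulCommutative ρ hρ H
  exact ⟨by simpa using finrank_le_index ρ hρ H v hv0 hv,
    fun h => exists_eq_induced ρ hρ H v hv0 hv (by simpa using h)⟩

theorem exists_eq_induced_of_degree_one {G : Type*} [Group G] [Fintype G]
    (ρ : Representation ℂ G (Fin 1 → ℂ)) (hρ : ρ.IsIrreducible) :
    ∃ (H : Subgroup G) (lam : H →* ℂˣ), ρ.character = induced H lam := by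
  refine ⟨⊤, exists_eq_induced ρ hρ ⊤ 1 one_ne_zero (fun h => ⟨ρ h 1 0, ?_⟩) (by simp)⟩
  ext i
  fin_cases i
  simp

open scoped MonoidAlgebra in
/-- For a group with at most four irreducible characters, every degree is `1` or the index of an
abelian subgroup. -/
theorem degree_of_encard_Irr_le_four {G : Type*} [Group G] [Fintype G]
    (hr : (Irr G).encard ≤ 4) {n : ℕ} (ρ : Representation ℂ G (Fin n → ℂ))
    (hρ : ρ.IsIrreducible) :
    n = 1 ∨ ∃ H : Subgroup G, IsMulCommutative H ∧ H.index = n := by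
  have hG : (Nat.card G : ℂ) ≠ 0 := by exact_mod_cast Nat.card_pos.ne'
  have : NeZero (Nat.card G : ℂ) := ⟨hG⟩
  obtain ⟨s, d, hd, ⟨e⟩⟩ := IsSemisimpleRing.exists_algEquiv_pi_matrix_of_isAlgClosed ℂ ℂ[G]
  replace hd : ∀ i, d i ≠ 0 := fun i => (hd i).out
  have hs4 : s ≤ 4 := by exact_mod_cast (card_blocks_le_encard_Irr e hd).trans hr
  have hks := card_conjClasses_le_blocks e hd
  have hsq := sum_sq_blocks e
  rw [Fintype.card_eq_nat_card] at hsq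
  obtain ⟨i₀, hi₀⟩ := exists_block_degree_one e hd
  obtain ⟨j, rfl⟩ := exists_block_degree e hd ρ hρ
  have hN := card_of_card_conjClasses_le_four (hks.trans hs4)
  rcases sum_of_card_le_four i₀ (fun i => d i ^ 2) (by simpa using hs4) with
    ⟨hc, hall, hs⟩ | ⟨hc, x, hall, hs⟩ | ⟨hc, x, y, hall, hs⟩ |
    ⟨hc, x, y, z, hall, hs⟩ <;>
    simp only [hsq, hi₀, one_pow] at hs <;> rw [Fintype.card_fin] at hc
  · exact Or.inl (hall j ▸ hi₀)
  · have hx := Nat.pow_le_pow_left (Nat.one_le_iff_ne_zero.2 (hd x)) 2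
    have hx4 : d x ≤ 4 := le_four_of_sq_add_eq (k := 1) (N := Nat.card G) (by omega) (by omega)
    left
    rcases hall j with rfl | rfl
    · exact hi₀
    · generalize d j = t at *
      interval_cases t <;> omega
  · have hx4 : d x ≤ 4 := le_four_of_sq_add_eq (k := 1 + d y ^ 2) (N := Nat.card G) (by omega)
      (by omega)
    have hy4 : d y ≤ 4 := le_four_of_sq_add_eq (k := 1 + d x ^ 2) (N := Nat.card G) (by omega)
      (by omega)
    have hxy : (d x = 1 ∧ d y = 1) ∨
        (Nat.card G = 6 ∧ (d x = 1 ∨ d x = 2) ∧ (d y = 1 ∨ d y = 2)) := by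
      have hx := hd x
      have hy := hd y
      clear hall
      generalize d x = t at *
      generalize d y = t' at *
      interval_cases t <;> interval_cases t' <;> omega
    obtain h | ⟨h6, h2⟩ : d j = 1 ∨ (Nat.card G = 6 ∧ d j = 2) := by
      rcases hall j with rfl | rfl | rfl <;> omega
    · exact Or.inl h
    · exact Or.inr (h2 ▸ exists_isMulCommutative_index (p := 3) (a := 1) (by norm_num) (by norm_num)
        (by omega))
  · have hx := Nat.pow_le_pow_left (Nat.one_le_iff_ne_zero.2 (hd x)) 2
    have hy := Nat.pow_le_pow_left (Nat.one_le_iff_ne_zero.2 (hd y)) 2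
    have hz := Nat.pow_le_pow_left (Nat.one_le_iff_ne_zero.2 (hd z)) 2
    have hdeg := degrees_of_one_add_three_squares (hd x) (hd y) (hd z) (N := Nat.card G)
      (by omega) hs.symm
    have h18 : Nat.card G ≠ 18 := by
      -- an abelian subgroup of order `9` bounds the degrees by `2`
      intro h
      obtain ⟨H, hH, hi⟩ := exists_isMulCommutative_index (G := G) (p := 3) (a := 2) (m := 2)
        (by norm_num) (by norm_num) (by omega)
      have hle : ∀ i, d i ≤ 2 := fun i => hi ▸
        (finrank_le_index_of_isMulCommutative (blockRep e i) (blockRep_isIrreducible e i (hd i))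
          H).1
      have := hle x
      have := hle y
      have := hle z
      omega
    obtain h | ⟨hN, hj⟩ | ⟨hN, hj⟩ :
        d j = 1 ∨ (Nat.card G = 10 ∧ d j = 2) ∨ (Nat.card G = 12 ∧ d j = 3) := by
      rcases hall j with rfl | rfl | rfl | rfl <;> omega
    · exact Or.inl h
    · exact Or.inr (hj ▸ exists_isMulCommutative_index (p := 5) (a := 1) (by norm_num) (by norm_num)
        (by omega))
    · exact Or.inr (hj ▸ exists_isMulCommutative_index (p := 2) (a := 2) (by norm_num) (by norm_num)
        (by omega))

end MonomialAlgebra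

theorem mainTheorem5 {K : Type*} [Field K] {G : Type*} [Group G] [Fintype G]
    (hAM : MonomialAlgebra.IsAlmostMonomialGroup G)
    (hr : (MonomialAlgebra.Irr G).encard ≤ 4)
    (hI : MonomialAlgebra.toricIdeal K G = ⊥) :
    MonomialAlgebra.IsMonomialGroup G := by
  rintro _ ⟨n, ρ, hρ, rfl⟩
  rcases MonomialAlgebra.degree_of_encard_Irr_le_four hr ρ hρ with rfl | ⟨H, hH, hi⟩
  · exact MonomialAlgebra.exists_eq_induced_of_degree_one ρ hρ
  · exact ⟨H, (MonomialAlgebra.finrank_le_index_of_isMulCommutative ρ hρ H).2 hi.symm⟩
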